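/- A skew (left) brace is a set $B$ with two operations $+$ and $\cdot$ such that $(B,+)$ and $(B,\cdot)$ are groups (not necessarily abelian) and $x\cdot(y+z)=x\cdot y-x+x\cdot z$ for all $x,y,z\in B$; the two groups have the same identity $0$. For $a,b\in B$ put $\lambda_a(b)=-a+a\cdot b$; then $\lambda:(B,\cdot)\to\operatorname{Aut}(B,+)$ is a homomorphism, and $\operatorname{Soc}(B)=\operatorname{Ker}\lambda\cap Z(B,+)$. A subbrace of $B$ is a subset that is a subgroup of both $(B,+)$ and $(B,\cdot)$; an ideal is a subbrace $I$ that is normal in $(B,+)$ and in $(B,\cdot)$ and satisfies $\lambda_b(I)\subseteq I$ for all $b\in B$; then $B/I$ is a skew brace. A maximal subbrace is a proper subbrace that is not contained in any other proper subbrace. The skew brace $B$ is supersoluble if it has a finite chain of ideals $\{0\}=I_0\le I_1\le\dots\le I_n=B$ such that, for all $0\le i<n$, either $(I_{i+1}/I_i,+)$ is infinite cyclic and $I_{i+1}/I_i\le\operatorname{Soc}(B/I_i)$, or $I_{i+1}/I_i$ has prime order. If $C$ is a subbrace of $B$ such that the indices $|(B,+):(C,+)|$ and $|(B,\cdot):(C,\cdot)|$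 are finite and equal, their common value is called the index $|B:C|$. **Theorem.** Let $B$ be a supersoluble skew brace and let $C$ be a maximal subbrace of $B$. Then the index $|B:C|$ exists and is a prime number. In particular, $(C,+)$ is a maximal subgroup of $(B,+)$ of prime index, and $(C,\cdot)$ is a maximal subgroup of $(B,\cdot)$ of prime index. -/

import Mathlib

/-- A skew (left) brace: two group structures `(B, +)` and `(B, *)` on the same set (neither is
assumed commutative) satisfying the skew distributive law `x (y + z) = x y - x + x z`. -/
class SkewBrace (B : Type*) extends AddGroup B, Group B where
  skew_distrib : ∀ x y z : B, x * (y + z) = x * y - x + x * z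

namespace SkewBrace

variable {B : Type*} [SkewBrace B]

theorem mul_zero_eq (x : B) : x * 0 = x := by
  have h := skew_distrib x 0 0
  rw [add_zero] at h
  have h2 : x * 0 - x = 0 := by
    have h3 : 0 + x * 0 = (x * 0 - x) + x * 0 := by rw [zero_add]; exact h
    exact (add_right_cancel h3).symm
  exact sub_eq_zero.mp h2

theorem one_eq_zero : (1 : B) = 0 := by
  have h := mul_zero_eq (1 : B)
  rw [one_mul] at h
  exact h.symm

theorem lam_add_aux (a b c : B) : -a + a * (b + c) = (-a + a * b) + (-a + a * c) := by
  rw [skew_distrib, sub_eq_add_neg]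
  simp only [add_assoc]

theorem lam_mul_aux (a b c : B) : -(a * b) + (a * b) * c = -a + a * (-b + b * c) := by
  have h : a * (b * c) = a * b - a + a * (-b + b * c) := by
    rw [← skew_distrib, add_neg_cancel_left]
  rw [mul_assoc, h, sub_eq_add_neg, add_assoc, neg_add_cancel_left]

/-- The automorphism `lam_a : b ↦ -a + a b` of `(B, +)`. -/
def lam (a : B) : B ≃+ B where
  toFun b := -a + a * b
  invFun b := -a⁻¹ + a⁻¹ * b
  left_inv b := by
    change -a⁻¹ + a⁻¹ * (-a + a * b) = b
    rw [← lam_mul_aux, inv_mul_cancel, one_mul, one_eq_zero, neg_zero, zero_add]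
  right_inv b := by
    change -a + a * (-a⁻¹ + a⁻¹ * b) = b
    rw [← lam_mul_aux, mul_inv_cancel, one_mul, one_eq_zero, neg_zero, zero_add]
  map_add' b c := lam_add_aux a b c

theorem lam_apply (a b : B) : lam a b = -a + a * b := rfl

/-- `a ↦ lam_a` is a homomorphism from `(B, *)` to the automorphism group of `(B, +)`. -/
theorem lam_mul (a b c : B) : lam (a * b) c = lam a (lam b c) := lam_mul_aux a b c

theorem lam_one (b : B) : lam 1 b = b := by
  rw [lam_apply, one_mul, one_eq_zero, neg_zero, zero_add]

variable (B) in
/-- The socle `Soc(B) = Ker lam ∩ Z(B, +)`. -/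
def socle : Set B :=
  {a : B | lam a = AddEquiv.refl B} ∩ (AddSubgroup.center B : Set B)

variable (B) in
/-- A subbrace: a subset which is a subgroup of both `(B, +)` and `(B, *)`. -/
structure Subbrace extends AddSubgroup B, Subgroup B

namespace Subbrace

instance : SetLike (Subbrace B) B where
  coe C := C.carrier
  coe_injective C D h := by
    cases C; cases D
    congr
    exact SetLike.coe_injective h

/-- Subbraces are ordered by inclusion. -/
instance : PartialOrder (Subbrace B) := PartialOrder.ofSetLike (Subbrace B) B

instance : OrderTop (Subbrace B) where
  top :=
    { (⊤ : AddSubgroup B) with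
      mul_mem' := fun _ _ => trivial
      one_mem' := trivial
      inv_mem' := fun _ => trivial }
  le_top _ _ _ := trivial

/-- `C` has (finite) index `n` in `B`: both `(C, +)` in `(B, +)` and `(C, *)` in `(B, *)` have
finite index, and both indices are equal to `n`. -/
def HasIndex (C : Subbrace B) (n : ℕ) : Prop :=
  C.toAddSubgroup.FiniteIndex ∧ C.toSubgroup.FiniteIndex ∧
    C.toAddSubgroup.index = n ∧ C.toSubgroup.index = n

end Subbrace

variable (B) in
/-- An ideal: a subbrace that is invariant under all `lam_b`, normal in `(B, +)` and normal in
`(B, *)`. -/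
structure BraceIdeal extends Subbrace B where
  lam_mem : ∀ (b : B) {x : B}, x ∈ carrier → lam b x ∈ carrier
  add_normal : toAddSubgroup.Normal
  mul_normal : toSubgroup.Normal

namespace BraceIdeal

variable (I : BraceIdeal B)

instance : I.toAddSubgroup.Normal := I.add_normal

instance : I.toSubgroup.Normal := I.mul_normal

/-- Additive and multiplicative cosets of an ideal agree. -/
theorem neg_add_mem_iff (a b : B) : -a + b ∈ I.toAddSubgroup ↔ a⁻¹ * b ∈ I.toSubgroup := by
  have h1 : -a + b = lam a (a⁻¹ * b) := by rw [lam_apply, mul_inv_cancel_left]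
  have h2 : a⁻¹ * b = lam a⁻¹ (-a + b) := by
    rw [h1, ← lam_mul, inv_mul_cancel, lam_one]
  constructor
  · intro h
    rw [h2]
    exact I.lam_mem a⁻¹ h
  · intro h
    rw [h1]
    exact I.lam_mem a h

/-- The underlying set of the quotient brace `B / I`: the cosets `b + I = b I`. -/
def Quot : Type _ := B ⧸ I.toAddSubgroup

namespace Quot

instance : AddGroup I.Quot := inferInstanceAs (AddGroup (B ⧸ I.toAddSubgroup))

/-- The projection `B → B / I` as a homomorphism of additive groups. -/
def mkAdd : B →+ I.Quot := QuotientAddGroup.mk' I.toAddSubgroup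

theorem mkAdd_surjective : Function.Surjective (mkAdd I) :=
  QuotientAddGroup.mk'_surjective I.toAddSubgroup

theorem mkAdd_eq_iff (a b : B) : mkAdd I a = mkAdd I b ↔ a⁻¹ * b ∈ I.toSubgroup :=
  (QuotientAddGroup.eq (s := I.toAddSubgroup)).trans (I.neg_add_mem_iff a b)

/-- Multiplication on `B / I`, induced by that of `B`. -/
instance : Mul I.Quot where
  mul := Quotient.map₂ (· * ·) (by
    intro a a' ha b b' hb
    refine Quotient.exact ((mkAdd_eq_iff I (a * b) (a' * b')).mpr ?_)
    have ha' : a⁻¹ * a' ∈ I.toSubgroup := (mkAdd_eq_iff I a a').mp (Quotient.sound ha)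
    have hb' : b⁻¹ * b' ∈ I.toSubgroup := (mkAdd_eq_iff I b b').mp (Quotient.sound hb)
    have h := I.toSubgroup.mul_mem (I.mul_normal.conj_mem _ ha' b⁻¹) hb'
    have e : (a * b)⁻¹ * (a' * b') = b⁻¹ * (a⁻¹ * a') * b⁻¹⁻¹ * (b⁻¹ * b') := by group
    rw [e]
    exact h)

/-- Inversion on `B / I`, induced by that of `B`. -/
instance : Inv I.Quot where
  inv := Quotient.map (·⁻¹) (by
    intro a a' ha
    refine Quotient.exact ((mkAdd_eq_iff I a⁻¹ a'⁻¹).mpr ?_)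
    have ha' : a⁻¹ * a' ∈ I.toSubgroup := (mkAdd_eq_iff I a a').mp (Quotient.sound ha)
    have h := I.mul_normal.conj_mem _ (I.toSubgroup.inv_mem ha') a
    have e : a⁻¹⁻¹ * a'⁻¹ = a * (a⁻¹ * a')⁻¹ * a⁻¹ := by group
    rw [e]
    exact h)

instance : One I.Quot := ⟨mkAdd I 1⟩

theorem mkAdd_mul (a b : B) : mkAdd I (a * b) = mkAdd I a * mkAdd I b := rfl

theorem mkAdd_one : mkAdd I 1 = 1 := rfl

theorem mkAdd_inv (a : B) : mkAdd I a⁻¹ = (mkAdd I a)⁻¹ := rfl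

instance : Group I.Quot :=
  Group.ofLeftAxioms
    (by
      intro x y z
      obtain ⟨a, rfl⟩ := mkAdd_surjective I x
      obtain ⟨b, rfl⟩ := mkAdd_surjective I y
      obtain ⟨c, rfl⟩ := mkAdd_surjective I z
      simp only [← mkAdd_mul, mul_assoc])
    (by
      intro x
      obtain ⟨a, rfl⟩ := mkAdd_surjective I x
      rw [← mkAdd_one, ← mkAdd_mul, one_mul])
    (by
      intro x
      obtain ⟨a, rfl⟩ := mkAdd_surjective I x
      rw [← mkAdd_inv, ← mkAdd_mul, inv_mul_cancel, mkAdd_one])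

/-- The quotient brace `B / I`. -/
instance : SkewBrace I.Quot where
  skew_distrib x y z := by
    obtain ⟨a, rfl⟩ := mkAdd_surjective I x
    obtain ⟨b, rfl⟩ := mkAdd_surjective I y
    obtain ⟨c, rfl⟩ := mkAdd_surjective I z
    rw [← map_add, ← mkAdd_mul, skew_distrib, map_add, map_sub, mkAdd_mul, mkAdd_mul]

end Quot

/-- The factor `(J / I, +)`, as a subgroup of `(B / I, +)` (used for ideals `I ≤ J`). -/
def factor (J : BraceIdeal B) : AddSubgroup I.Quot := J.toAddSubgroup.map (Quot.mkAdd I)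

end BraceIdeal

variable (B) in
/-- `B` is supersoluble: there is a finite chain of ideals `{0} = I 0 ≤ I 1 ≤ ... ≤ I n = B` such
that for each `i < n`, either `(I (i+1) / I i, +)` is infinite cyclic and
`I (i+1) / I i ≤ Soc(B / I i)`, or `I (i+1) / I i` has prime order. -/
def IsSupersoluble : Prop :=
  ∃ (n : ℕ) (I : ℕ → BraceIdeal B),
    ((I 0).carrier = {0}) ∧ ((I n).carrier = Set.univ) ∧
    ∀ i < n, (I i).toSubbrace ≤ (I (i + 1)).toSubbrace ∧
      ((IsAddCyclic ((I i).factor (I (i + 1))) ∧ Infinite ((I i).factor (I (i + 1))) ∧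
          ((I i).factor (I (i + 1)) : Set (I i).Quot) ⊆ socle (I i).Quot) ∨
        (Nat.card ((I i).factor (I (i + 1)))).Prime)

end SkewBrace

namespace SkewBrace

variable {B : Type*} [SkewBrace B]

theorem mul_eq_add_lam (a b : B) : a * b = a + lam a b := by
  rw [lam_apply, add_neg_cancel_left]

namespace BraceIdeal

/-- The projection `B → B / I` as a homomorphism of multiplicative groups. -/
def mkMul (I : BraceIdeal B) : B →* I.Quot :=
  MonoidHom.mk' (Quot.mkAdd I) (Quot.mkAdd_mul I)

theorem mkAdd_eq_zero (I : BraceIdeal B) (x : B) : Quot.mkAdd I x = 0 ↔ x ∈ I.carrier :=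
  QuotientAddGroup.eq_zero_iff (N := I.toAddSubgroup) x

theorem comap_mkAdd_bot (I : BraceIdeal B) :
    (⊥ : AddSubgroup I.Quot).comap (Quot.mkAdd I) = I.toAddSubgroup :=
  AddSubgroup.ext I.mkAdd_eq_zero

theorem comap_mkMul_bot (I : BraceIdeal B) :
    (⊥ : Subgroup I.Quot).comap I.mkMul = I.toSubgroup :=
  Subgroup.ext fun x => by
    change Quot.mkAdd I x = 1 ↔ _
    rw [one_eq_zero]
    exact I.mkAdd_eq_zero x

theorem lam_mkAdd (I : BraceIdeal B) (a b : B) :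
    lam (Quot.mkAdd I a) (Quot.mkAdd I b) = Quot.mkAdd I (lam a b) := by
  rw [lam_apply, lam_apply, map_add, map_neg, Quot.mkAdd_mul]

/-- The preimage in `B` of an ideal of `B / I`. -/
def comap (I : BraceIdeal B) (S : BraceIdeal I.Quot) : BraceIdeal B where
  toSubbrace :=
    { S.toAddSubgroup.comap (Quot.mkAdd I) with
      mul_mem' := fun {_ _} ha hb => (S.toSubgroup.comap I.mkMul).mul_mem ha hb
      one_mem' := (S.toSubgroup.comap I.mkMul).one_mem
      inv_mem' := fun {_} ha => (S.toSubgroup.comap I.mkMul).inv_mem ha }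
  lam_mem b x hx := by
    change Quot.mkAdd I (lam b x) ∈ S.carrier
    rw [← lam_mkAdd]
    exact S.lam_mem _ hx
  add_normal := inferInstanceAs (S.toAddSubgroup.comap (Quot.mkAdd I)).Normal
  mul_normal := inferInstanceAs (S.toSubgroup.comap I.mkMul).Normal

/-- The sum `C + I` of a subbrace and an ideal. -/
def sup (I : BraceIdeal B) (C : Subbrace B) : Subbrace B :=
  { (C.toAddSubgroup.map (Quot.mkAdd I)).comap (Quot.mkAdd I) with
    mul_mem' := fun {_ _} ha hb => ((C.toSubgroup.map I.mkMul).comap I.mkMul).mul_mem ha hb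
    one_mem' := ((C.toSubgroup.map I.mkMul).comap I.mkMul).one_mem
    inv_mem' := fun {_} ha => ((C.toSubgroup.map I.mkMul).comap I.mkMul).inv_mem ha }

theorem le_sup (I : BraceIdeal B) (C : Subbrace B) : C ≤ I.sup C :=
  fun x hx => ⟨x, hx, rfl⟩

theorem subset_sup (I : BraceIdeal B) (C : Subbrace B) : I.toSubbrace ≤ I.sup C :=
  fun x hx => ⟨0, C.toAddSubgroup.zero_mem,
    (map_zero (Quot.mkAdd I)).trans ((I.mkAdd_eq_zero x).mpr hx).symm⟩

/-- A maximal subbrace supplements every ideal that it does not contain. -/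
theorem exists_mkAdd_eq_of_isCoatom (I : BraceIdeal B) {C : Subbrace B} (hC : IsCoatom C)
    (h : ¬ I.toSubbrace ≤ C) (x : B) : ∃ c ∈ C, Quot.mkAdd I c = Quot.mkAdd I x := by
  have hlt : C < I.sup C := lt_of_le_of_ne (I.le_sup C) fun e => h (e ▸ I.subset_sup C)
  have hx : x ∈ I.sup C := hC.2 _ hlt ▸ (trivial : x ∈ (⊤ : Subbrace B))
  exact hx

/-- An ideal has the same additive and multiplicative index in any subbrace. -/
theorem relIndex_toSubgroup (K : BraceIdeal B) (J : Subbrace B) :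
    K.toSubgroup.relIndex J.toSubgroup = K.toAddSubgroup.relIndex J.toAddSubgroup := by
  rw [← comap_mkAdd_bot, ← comap_mkMul_bot, Subgroup.relIndex_comap, AddSubgroup.relIndex_comap,
    Subgroup.relIndex_bot_left, AddSubgroup.relIndex_bot_left]
  rfl

theorem relIndex_eq_card_factor (I J : BraceIdeal B) :
    I.toAddSubgroup.relIndex J.toAddSubgroup = Nat.card (I.factor J) := by
  conv_lhs => rw [← comap_mkAdd_bot I]
  rw [AddSubgroup.relIndex_comap, AddSubgroup.relIndex_bot_left]
  rfl

end BraceIdeal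

/-- A `lam`-invariant additive subgroup of the socle is an ideal. -/
def idealOfSubsetSocle (S : AddSubgroup B) (hS : (S : Set B) ⊆ socle B)
    (hlam : ∀ b, ∀ x ∈ S, lam b x ∈ S) : BraceIdeal B :=
  have hadd : ∀ x ∈ S, ∀ y, x * y = x + y := fun x hx y => by
    have h : lam x = AddEquiv.refl B := (hS hx).1
    rw [mul_eq_add_lam, h]
    rfl
  have hinv : ∀ x ∈ S, x⁻¹ = -x := fun x hx => by
    rw [inv_eq_iff_mul_eq_one, hadd x hx, add_neg_cancel, one_eq_zero]
  { toSubbrace :=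
      { S with
        mul_mem' := fun {x y} hx hy => by
          rw [hadd x hx]
          exact S.add_mem hx hy
        one_mem' := by
          rw [one_eq_zero]
          exact S.zero_mem
        inv_mem' := fun {x} hx => by
          change x⁻¹ ∈ S
          rw [hinv x hx]
          exact S.neg_mem hx }
    lam_mem := fun b x hx => hlam b x hx
    add_normal := ⟨fun x hx g => by
      have h := AddSubgroup.mem_center_iff.mp (hS hx).2 g
      rw [h, add_neg_cancel_right]
      exact hx⟩
    mul_normal := ⟨fun x hx g => by
      have h := AddSubgroup.mem_center_iff.mp (hS (hlam g x hx)).2 g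
      rw [mul_eq_add_lam g x, h, ← hadd _ (hlam g x hx), mul_inv_cancel_right]
      exact hlam g x hx⟩ }

open BraceIdeal in
/-- Let `J / I` be an infinite cyclic factor inside the socle of `B / I` and let `C` be a maximal
subbrace with `I ≤ C` and `¬ J ≤ C`. Then `C` contains an ideal of prime index in `J`. -/
theorem exists_ideal_relIndex_prime (I J : BraceIdeal B) {C : Subbrace B} (hC : IsCoatom C)
    (hIC : I.toSubbrace ≤ C) (hJC : ¬ J.toSubbrace ≤ C)
    (hcyc : IsAddCyclic (I.factor J)) (hinf : Infinite (I.factor J))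
    (hsoc : (I.factor J : Set I.Quot) ⊆ socle I.Quot) :
    ∃ K : BraceIdeal B, K.toSubbrace ≤ C ∧
      (K.toAddSubgroup.relIndex J.toAddSubgroup).Prime := by
  obtain ⟨γ, hγ⟩ : ∃ γ, AddSubgroup.zmultiples γ = I.factor J :=
    AddSubgroup.isAddCyclic_iff_exists_zmultiples_eq_top _ |>.mp hcyc
  have hγJ : γ ∈ I.factor J := hγ ▸ AddSubgroup.mem_zmultiples γ
  have hord : addOrderOf γ = 0 := by
    rw [← Nat.card_zmultiples, hγ, Nat.card_eq_zero_of_infinite]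
  have hinj : Function.Injective (zmultiplesHom I.Quot γ) := by
    intro m n h
    exact injective_zsmul_iff_not_isOfFinAddOrder.mpr (addOrderOf_eq_zero_iff.mp hord) h
  obtain ⟨k, hk⟩ : ∃ k : ℤ, (C.toAddSubgroup.map (Quot.mkAdd I)).comap (zmultiplesHom I.Quot γ)
      = AddSubgroup.zmultiples k := by
    obtain ⟨k, hk⟩ := Int.subgroup_cyclic
      ((C.toAddSubgroup.map (Quot.mkAdd I)).comap (zmultiplesHom I.Quot γ))
    exact ⟨k, hk.trans (AddSubgroup.zmultiples_eq_closure k).symm⟩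
  have hCk : ∀ n : ℤ, n • γ ∈ C.toAddSubgroup.map (Quot.mkAdd I) ↔ k ∣ n := fun n => by
    rw [← Int.mem_zmultiples_iff, ← hk]
    rfl
  have hmemC : ∀ x, Quot.mkAdd I x ∈ C.toAddSubgroup.map (Quot.mkAdd I) → x ∈ C := by
    rintro x ⟨c, hc, hcx⟩
    have h : -c + x ∈ I.carrier := by
      rw [← mkAdd_eq_zero, map_add, map_neg, hcx, neg_add_cancel]
    have h' := C.toAddSubgroup.add_mem hc (hIC h)
    rwa [add_neg_cancel_left] at h'
  have hk1 : k.natAbs ≠ 1 := by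
    intro h1
    refine hJC fun x hx => hmemC x ?_
    have hxJ : Quot.mkAdd I x ∈ AddSubgroup.zmultiples γ := hγ ▸ ⟨x, hx, rfl⟩
    obtain ⟨n, hn⟩ := AddSubgroup.mem_zmultiples_iff.mp hxJ
    rw [← hn, hCk]
    exact (Int.isUnit_iff_natAbs_eq.mpr h1).dvd
  obtain ⟨q, hq, hqk⟩ := Nat.exists_prime_and_dvd hk1
  have hqk' : (q : ℤ) ∣ k := Int.natCast_dvd.mpr hqk
  have hle : AddSubgroup.zmultiples ((q : ℤ) • γ) ≤ I.factor J :=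
    AddSubgroup.zmultiples_le_of_mem ((I.factor J).zsmul_mem hγJ _)
  let S : BraceIdeal I.Quot := idealOfSubsetSocle (AddSubgroup.zmultiples ((q : ℤ) • γ))
    (fun x hx => hsoc (hle hx)) (by
      intro b x hx
      obtain ⟨n, rfl⟩ := AddSubgroup.mem_zmultiples_iff.mp hx
      have hb : lam b γ ∈ AddSubgroup.zmultiples γ := by
        obtain ⟨b', rfl⟩ := Quot.mkAdd_surjective I b
        obtain ⟨g, hg, hgγ⟩ := hγJ
        rw [hγ, ← hgγ, lam_mkAdd]
        exact ⟨_, J.lam_mem b' hg, rfl⟩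
      obtain ⟨m, hm⟩ := AddSubgroup.mem_zmultiples_iff.mp hb
      rw [map_zsmul, map_zsmul, ← hm, smul_comm (q : ℤ) m γ]
      exact AddSubgroup.zsmul_mem _ (AddSubgroup.zsmul_mem _ (AddSubgroup.mem_zmultiples _) _) _)
  have hS : ∀ x, x ∈ (I.comap S).carrier ↔
      Quot.mkAdd I x ∈ AddSubgroup.zmultiples ((q : ℤ) • γ) := fun x => Iff.rfl
  refine ⟨I.comap S, ?_, ?_⟩
  · by_contra hnot
    obtain ⟨g, hg, hgγ⟩ := hγJ
    obtain ⟨c, hc, hcg⟩ := (I.comap S).exists_mkAdd_eq_of_isCoatom hC hnot g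
    have hd : -c + g ∈ (I.comap S).carrier := by
      rw [← mkAdd_eq_zero, map_add, map_neg, hcg, neg_add_cancel]
    obtain ⟨l, hl⟩ := AddSubgroup.mem_zmultiples_iff.mp ((hS _).mp hd)
    have hcγ : (1 - l * q : ℤ) • γ = Quot.mkAdd I c := by
      rw [map_add, map_neg, hgγ] at hl
      rw [sub_zsmul, one_zsmul, mul_zsmul, hl, neg_add_rev, neg_neg, add_neg_cancel_left]
    have hdvd : k ∣ 1 - l * q := (hCk _).mp (hcγ ▸ ⟨c, hc, rfl⟩)
    have h1 : (q : ℤ) ∣ 1 := (dvd_sub_left (dvd_mul_left _ _)).mp (hqk'.trans hdvd)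
    exact hq.one_lt.ne' (by exact_mod_cast Int.eq_one_of_dvd_one (by positivity) h1)
  · have hcomap : (AddSubgroup.zmultiples ((q : ℤ) • γ)).comap (zmultiplesHom I.Quot γ)
        = AddSubgroup.zmultiples (q : ℤ) := by
      ext n
      rw [AddSubgroup.mem_comap, AddSubgroup.mem_zmultiples_iff, AddSubgroup.mem_zmultiples_iff]
      refine exists_congr fun m => ?_
      rw [← mul_zsmul, smul_eq_mul]
      exact ⟨fun h => hinj h, fun h => congrArg (zmultiplesHom I.Quot γ) h⟩
    have hrange : (⊤ : AddSubgroup ℤ).map (zmultiplesHom I.Quot γ) = I.factor J := by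
      rw [← hγ, ← AddMonoidHom.range_eq_map]
      rfl
    have hrel : (I.comap S).toAddSubgroup.relIndex J.toAddSubgroup = q := by
      change ((AddSubgroup.zmultiples ((q : ℤ) • γ)).comap (Quot.mkAdd I)).relIndex _ = q
      rw [AddSubgroup.relIndex_comap]
      change (AddSubgroup.zmultiples ((q : ℤ) • γ)).relIndex (I.factor J) = q
      rw [← hrange, ← AddSubgroup.relIndex_comap, hcomap, AddSubgroup.relIndex_top_right,
        Int.index_zmultiples, Int.natAbs_natCast]
    rwa [hrel]

end SkewBrace

/-- A subgroup of prime index is maximal. -/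
@[to_additive /-- An additive subgroup of prime index is maximal. -/]
theorem Subgroup.isCoatom_of_prime_index {G : Type*} [Group G] {H : Subgroup G}
    (h : H.index.Prime) : IsCoatom H := by
  refine ⟨fun e => h.one_lt.ne' (Subgroup.index_eq_one.mpr e), fun K hK => ?_⟩
  have hmul := Subgroup.relIndex_mul_index hK.le
  rcases (Nat.dvd_prime h).mp (Dvd.intro_left _ hmul) with h1 | h1
  · exact Subgroup.index_eq_one.mp h1
  · rw [h1] at hmul
    exact absurd (Subgroup.relIndex_eq_one.mp (Nat.eq_of_mul_eq_mul_right h.pos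
      (hmul.trans (one_mul _).symm))) hK.not_ge

/-- If `K ≤ H` has prime index in the subgroup `N`, and `H` is a proper subgroup with
`H N = G`, then `H` has the same index in `G`. -/
@[to_additive /-- If `K ≤ H` has prime index in the subgroup `N`, and `H` is a proper
subgroup with `H + N = G`, then `H` has the same index in `G`. -/]
theorem Subgroup.index_eq_of_relIndex_prime {G : Type*} [Group G] {H K N : Subgroup G}
    (hKH : K ≤ H) (hp : (K.relIndex N).Prime) (hN : ¬ N ≤ H)
    (hHN : ∀ x, ∃ c ∈ H, c⁻¹ * x ∈ N) : H.index = K.relIndex N := by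
  have hrel : H.relIndex N = H.index := by
    have hst : MulAction.stabilizer N ((1 : G) : G ⧸ H) = H.subgroupOf N := by
      ext n
      rw [MulAction.mem_stabilizer_iff, Subgroup.mem_subgroupOf]
      change (((n : G) * 1 : G) : G ⧸ H) = ((1 : G) : G ⧸ H) ↔ _
      rw [mul_one, eq_comm, QuotientGroup.eq, inv_one, one_mul]
    rw [Subgroup.relIndex, ← hst, MulAction.index_stabilizer]
    refine (congrArg Set.ncard (Set.eq_univ_of_forall fun y => ?_)).trans (Set.ncard_univ _)
    obtain ⟨x, rfl⟩ := QuotientGroup.mk_surjective y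
    obtain ⟨c, hc, hx⟩ := hHN x⁻¹
    refine ⟨⟨_, N.inv_mem hx⟩, ?_⟩
    change (((c⁻¹ * x⁻¹)⁻¹ * 1 : G) : G ⧸ H) = (x : G ⧸ H)
    rw [QuotientGroup.eq]
    simpa using H.inv_mem hc
  rcases (Nat.dvd_prime hp).mp (Subgroup.relIndex_dvd_of_le_left N hKH) with h | h
  · exact absurd (Subgroup.relIndex_eq_one.mp h) hN
  · rw [← hrel, h]

/-- `IsCoatom` says "maximal": for `C` among all subbraces, and for `(C, +)`, `(C, *)` among all
subgroups of `(B, +)`, `(B, *)`. -/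
theorem theorem3p14 {B : Type*} [SkewBrace B] (hB : SkewBrace.IsSupersoluble B)
    (C : SkewBrace.Subbrace B) (hC : IsCoatom C) :
    (∃ p : ℕ, p.Prime ∧ C.HasIndex p) ∧
      (IsCoatom C.toAddSubgroup ∧ C.toAddSubgroup.index.Prime) ∧
      (IsCoatom C.toSubgroup ∧ C.toSubgroup.index.Prime) := by
  obtain ⟨n, I, h0, hn, hstep⟩ := hB
  have hI0 : (I 0).toSubbrace ≤ C := fun x hx => by
    have hx' : x ∈ (I 0).carrier := hx
    rw [h0] at hx'
    rw [Set.mem_singleton_iff.mp hx']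
    exact C.toAddSubgroup.zero_mem
  have hIn : ¬ (I n).toSubbrace ≤ C := fun h => hC.1 (top_le_iff.mp fun x _ => h (by
    change x ∈ (I n).carrier
    rw [hn]
    trivial))
  obtain ⟨i, hi, hIC, hJC⟩ : ∃ i < n, (I i).toSubbrace ≤ C ∧ ¬ (I (i + 1)).toSubbrace ≤ C := by
    by_contra! hcon
    have hall : ∀ j ≤ n, (I j).toSubbrace ≤ C := fun j => by
      induction j with
      | zero => exact fun _ => hI0
      | succ j ih => exact fun hj => hcon j hj (ih (Nat.le_of_succ_le hj))
    exact hIn (hall n le_rfl)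
  obtain ⟨K, hKC, hp⟩ : ∃ K : SkewBrace.BraceIdeal B, K.toSubbrace ≤ C ∧
      (K.toAddSubgroup.relIndex (I (i + 1)).toAddSubgroup).Prime := by
    rcases (hstep i hi).2 with ⟨hcyc, hinf, hsoc⟩ | hprime
    · exact SkewBrace.exists_ideal_relIndex_prime (I i) (I (i + 1)) hC hIC hJC hcyc hinf hsoc
    · exact ⟨I i, hIC, by rwa [SkewBrace.BraceIdeal.relIndex_eq_card_factor]⟩
  have hcov := (I (i + 1)).exists_mkAdd_eq_of_isCoatom hC hJC
  have hadd : C.toAddSubgroup.index = K.toAddSubgroup.relIndex (I (i + 1)).toAddSubgroup :=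
    AddSubgroup.index_eq_of_relIndex_prime hKC hp hJC fun x => by
      obtain ⟨c, hc, hcx⟩ := hcov x
      exact ⟨c, hc, ((I (i + 1)).neg_add_mem_iff c x).mpr
        ((SkewBrace.BraceIdeal.Quot.mkAdd_eq_iff _ c x).mp hcx)⟩
  have hmul : C.toSubgroup.index = K.toAddSubgroup.relIndex (I (i + 1)).toAddSubgroup := by
    rw [← K.relIndex_toSubgroup] at hp ⊢
    refine Subgroup.index_eq_of_relIndex_prime hKC hp hJC fun x => ?_
    obtain ⟨c, hc, hcx⟩ := hcov x
    exact ⟨c, hc, (SkewBrace.BraceIdeal.Quot.mkAdd_eq_iff _ c x).mp hcx⟩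
  have hpa : C.toAddSubgroup.index.Prime := hadd ▸ hp
  have hpm : C.toSubgroup.index.Prime := hmul ▸ hp
  exact ⟨⟨_, hp, ⟨hpa.ne_zero⟩, ⟨hpm.ne_zero⟩, hadd, hmul⟩,
    ⟨AddSubgroup.isCoatom_of_prime_index hpa, hpa⟩, ⟨Subgroup.isCoatom_of_prime_index hpm, hpm⟩⟩
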